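/- Let $\Upsilon$ be a measurable space, let $\Omega=\Upsilon^{\mathbb Z^2}$ carry the product $\sigma$-algebra, and let $\vartheta_v(\omega)(j)=\omega(j+v)$ for $v,j\in\mathbb Z^2$. Let $P$ be a stationary random field, that is, a probability measure on $\Omega$ that is invariant under all shifts $\vartheta_v$, $v\in\mathbb Z^2$. For $\lambda,t\in\mathbb R$ and $z\in\mathbb Z$ put $L_{\lambda,t}(z)=(z,\lfloor \lambda z+t\rfloor)$, and write $\omega(L_{\lambda,t}(i,\dots,i+m-1))=\big(\omega(L_{\lambda,t}(i)),\dots,\omega(L_{\lambda,t}(i+m-1))\big)\in\Upsilon^m$. Let $P_{\lambda,t,m}$ be the distribution of $\omega(L_{\lambda,t}(0,\dots,m-1))$ under $P$, and let $\tau(t)=t+\lambda \bmod 1$. Let $m\in\mathbb N$, $\lambda\in[0,1]$, and let $f:\Upsilon^m\to\mathbb R$ be integrable with respect to $P_{\lambda,t,m}$ for every $t\in[0,1]$. Put $$A_n(t,\omega)=\frac1n\sum_{i=0}^{n-1}f\big(\omega(L_{\lambda,t}(i,\dots,i+m-1))\big).$$ Then $A_n(t,\cdot)\in L^1(P)$ for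 all $n$ and all $t\in[0,1]$, and the following hold. (i) Let $\lambda=p/q$ with $p\in\mathbb Z$, $q\in\mathbb N$, $q\geq 1$, without common divisor. Suppose that the shift $\vartheta_{(q,p)}$ is ergodic with respect to $P$ (this is the case, in particular, if $P$ is ergodic with respect to each shift $\vartheta_v$, $v\ne 0$). Then, with $$c(t)=\frac1q\sum_{\nu=0}^{q-1}\int_{\Upsilon^m} f(y)\,P_{\lambda,\tau^\nu(t),m}(dy),$$ one has $\sup_{t\in[0,1]}\|A_n(t,\cdot)-c(t)\|_{L^1(P)}\to0$ as $n\to\infty$, and for $P$-almost every $\omega$, $A_n(t,\omega)\to c(t)$ uniformly in $t\in[0,1]$. (ii) Let $\lambda$ be irrational, suppose that for $P$-almost every $\omega$ the function $t\mapsto f\big(\omega(L_{\lambda,t}(0,\dots,m-1))\big)$ is Riemann-integrable on $[0,1]$, and suppose that $P$ is strongly mixing with respect to the shifts, i.e. $P(A\cap\vartheta_v^{-1}B)\to P(A)P(B)$ as $\|v\|\to\infty$ for all measurable $A,B\subseteq\Omega$. Then $t\mapsto\int f\,dP_{\lambda,t,m}$ is integrable on $[0,1]$ and $$\sup_{t\in[0,1]}\Big\|A_n(t,\cdot)-\int_0^1\int_{\Upsilon^m}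 f(y)\,P_{\lambda,s,m}(dy)\,ds\Big\|_{L^1(P)}\to0\qquad(n\to\infty).$$ -/

import Mathlib

open MeasureTheory Filter Topology Set

noncomputable section

namespace Staircase

/-- Configurations on the planar lattice, with values in `Υ`. The σ-algebra on this space is
the product one, generated by the coordinate projections. -/
abbrev Config (Υ : Type*) := ℤ × ℤ → Υ

/-- The shift by `v`: `(shift v ω) j = ω (j + v)`. -/
def shift {Υ : Type*} (v : ℤ × ℤ) (ω : Config Υ) : Config Υ := fun j => ω (j + v)

/-- Invariance under all shifts. A random field is a probability measure with this property. -/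
def IsStationary {Υ : Type*} [MeasurableSpace Υ] (P : Measure (Config Υ)) : Prop :=
  ∀ v : ℤ × ℤ, MeasurePreserving (shift v) P P

/-- Strong mixing of the shift group: `P (A ∩ shift v ⁻¹ B) → P A * P B` as `‖v‖ → ∞`
(on `ℤ × ℤ` this is convergence along the cofinite filter), for all measurable `A`, `B`. -/
def IsStronglyMixing {Υ : Type*} [MeasurableSpace Υ] (P : Measure (Config Υ)) : Prop :=
  ∀ A B : Set (Config Υ), MeasurableSet A → MeasurableSet B →
    Tendsto (fun v : ℤ × ℤ => P (A ∩ shift v ⁻¹' B)) cofinite (𝓝 (P A * P B))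

/-- The rotation `t ↦ t + lam mod 1`. -/
def rotation (lam t : ℝ) : ℝ := Int.fract (t + lam)

/-- The lattice approximation `z ↦ (z, [lam z + t])` of the line with slope `lam` and
intercept `t`. -/
def stair (lam t : ℝ) (z : ℤ) : ℤ × ℤ := (z, ⌊lam * z + t⌋)

/-- The values of `ω` along the steps `i, …, i + m - 1` of the staircase. -/
def window {Υ : Type*} (lam t : ℝ) (m i : ℕ) (ω : Config Υ) : Fin m → Υ :=
  fun j => ω (stair lam t ((i : ℤ) + (j : ℕ)))

/-- The distribution under `P` of the values along the steps `0, …, m - 1`. -/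
def windowLaw {Υ : Type*} [MeasurableSpace Υ] (P : Measure (Config Υ)) (lam t : ℝ) (m : ℕ) :
    Measure (Fin m → Υ) :=
  P.map (window lam t m 0)

/-- The average of `f` over the first `n` windows along the staircase. -/
def stairAverage {Υ : Type*} {m : ℕ} (f : (Fin m → Υ) → ℝ) (lam t : ℝ) (n : ℕ)
    (ω : Config Υ) : ℝ :=
  (1 / (n : ℝ)) * ∑ i ∈ Finset.range n, f (window lam t m i ω)

/-- Riemann integrability of `g` on `[0, 1]`, as convergence of the Riemann sums over tagged
partitions when the mesh goes to zero. -/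
def RiemannIntegrableUnit (g : ℝ → ℝ) : Prop :=
  BoxIntegral.Integrable (ι := Fin 1)
    { lower := fun _ => 0, upper := fun _ => 1, lower_lt_upper := fun _ => one_pos }
    BoxIntegral.IntegrationParams.Riemann (fun x => g (x 0))
    BoxIntegral.BoxAdditiveMap.volume

end Staircase

end

/-! Both parts rest on a re-basing identity, `stair_add`: seen from its `i`-th point, the staircase
is again a staircase of the same slope, with intercept `Int.fract (t + lam * i)`. So the `i`-th
window is an initial window of a shifted configuration, and stationarity removes the shift from laws
and integrals.

For slope `p / q`, advancing `q` steps is exactly the shift by `(q, p)`. The indices split into `q`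
residue classes, and along each class the summands form an orbit of one ergodic map, so Birkhoff's
theorem and its `L¹` version apply; these are derived from the maximal ergodic theorem. The
staircase depends on `t` only through `⌊q * t⌋`, so `t ∈ [0, 1]` gives at most `q + 1` cases and
uniformity in `t` is automatic.

In the mixing case, an initial window with intercept in `[0, 1)` is determined by its vector of
heights. Only finitely many such shapes occur, each on a half-open interval of intercepts. Grouping
the indices by shape leaves two errors. The first is the fluctuation of a fixed function over the
translates at which its shape occurs: the first coordinate advances by one at each step, so
covariances decay whatever the heights, and a second-moment bound is uniform in `t`
(`uniformlyAveraging_of_isStronglyMixing`). The second is the frequency of each shape: the cell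
endpoints have the form `d - lam * j`, and for such intervals the rotation has discrepancy bounded
uniformly in `t` and `n` (`exists_card_discrepancy_le`). -/

noncomputable section

namespace Staircase

/-! ### Maximal, pointwise and `L¹` ergodic theorems. -/

section Birkhoff

variable {α : Type*} {T : α → α} {g : α → ℝ}

/-- The maximum of the Birkhoff sums of `g` of length at most `n` (including the empty one). -/
def maxBirkhoffSum (T : α → α) (g : α → ℝ) : ℕ → α → ℝ
  | 0, _ => 0
  | n + 1, x => max 0 (g x + maxBirkhoffSum T g n (T x))

lemma maxBirkhoffSum_nonneg (n : ℕ) (x : α) : 0 ≤ maxBirkhoffSum T g n x := by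
  cases n <;> simp [maxBirkhoffSum]

lemma maxBirkhoffSum_le_succ (n : ℕ) (x : α) :
    maxBirkhoffSum T g n x ≤ maxBirkhoffSum T g (n + 1) x := by
  induction n generalizing x with
  | zero => exact maxBirkhoffSum_nonneg 1 x
  | succ n ih => exact max_le_max le_rfl (add_le_add le_rfl (ih (T x)))

lemma birkhoffSum_le_maxBirkhoffSum (n : ℕ) (x : α) :
    birkhoffSum T g n x ≤ maxBirkhoffSum T g n x := by
  induction n generalizing x with
  | zero => simp [maxBirkhoffSum]
  | succ n ih =>
    rw [birkhoffSum_succ']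
    exact (add_le_add le_rfl (ih (T x))).trans (le_max_right _ _)

variable [MeasurableSpace α] {μ : Measure α}

lemma measurable_maxBirkhoffSum (hT : Measurable T) (hg : Measurable g) (n : ℕ) :
    Measurable (maxBirkhoffSum T g n) := by
  induction n with
  | zero => exact measurable_const
  | succ n ih => exact measurable_const.max (hg.add (ih.comp hT))

lemma integrable_maxBirkhoffSum [IsFiniteMeasure μ] (hT : MeasurePreserving T μ μ)
    (hgi : Integrable g μ) (n : ℕ) : Integrable (maxBirkhoffSum T g n) μ := by
  induction n with
  | zero => exact integrable_zero _ _ _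
  | succ n ih =>
    exact (integrable_const (0 : ℝ)).sup (hgi.add (hT.integrable_comp_of_integrable ih))

/-- Garsia's argument: with `M` the maximal sum, `M - M ∘ T ≤ g` where `M > 0`, and `M - M ∘ T ≤ 0`
elsewhere, while `M - M ∘ T` has integral zero by invariance. -/
lemma setIntegral_maxBirkhoffSum_pos_nonneg [IsFiniteMeasure μ] (hT : MeasurePreserving T μ μ)
    (hg : Measurable g) (hgi : Integrable g μ) (n : ℕ) :
    0 ≤ ∫ x in {x | 0 < maxBirkhoffSum T g n x}, g x ∂μ := by
  set M := maxBirkhoffSum T g n with hM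
  have hMm : Measurable M := measurable_maxBirkhoffSum hT.measurable hg n
  have hMi : Integrable M μ := integrable_maxBirkhoffSum hT hgi n
  have hMTi : Integrable (fun x => M (T x)) μ := hT.integrable_comp_of_integrable hMi
  have hs : MeasurableSet {x | 0 < M x} := measurableSet_lt measurable_const hMm
  have hMT : ∫ x, M (T x) ∂μ = ∫ x, M x ∂μ := by
    conv_rhs => rw [← hT.map_eq]
    rw [integral_map hT.aemeasurable (by rw [hT.map_eq]; exact hMi.1)]
  calc (0 : ℝ) = ∫ x, (M x - M (T x)) ∂μ := by rw [integral_sub hMi hMTi, hMT, sub_self]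
    _ ≤ ∫ x, {x | 0 < M x}.indicator g x ∂μ := by
      refine integral_mono (hMi.sub hMTi) (hgi.indicator hs) fun x => ?_
      have h0 : 0 ≤ M (T x) := maxBirkhoffSum_nonneg n _
      by_cases hx : 0 < M x
      · rw [indicator_of_mem (show x ∈ {x | 0 < M x} from hx)]
        have h1 : M x ≤ max 0 (g x + M (T x)) := maxBirkhoffSum_le_succ n x
        rcases le_max_iff.1 h1 with h | h <;> linarith
      · rw [indicator_of_notMem (show x ∉ {x | 0 < M x} from hx)]
        linarith
    _ = ∫ x in {x | 0 < M x}, g x ∂μ := integral_indicator hs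

/-- A consequence of the maximal ergodic theorem: a function almost all of whose orbits have a
positive Birkhoff sum has nonnegative integral. -/
lemma integral_nonneg_of_exists_birkhoffSum_pos [IsFiniteMeasure μ]
    (hT : MeasurePreserving T μ μ) (hg : Measurable g) (hgi : Integrable g μ)
    (h : ∀ᵐ x ∂μ, ∃ n, 0 < birkhoffSum T g n x) : 0 ≤ ∫ x, g x ∂μ := by
  have hmono : Monotone fun n => {x | 0 < maxBirkhoffSum T g n x} :=
    monotone_nat_of_le_succ fun n x hx => lt_of_lt_of_le hx (maxBirkhoffSum_le_succ n x)
  have hlim := tendsto_setIntegral_of_monotone (μ := μ) (f := g)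
    (fun n => measurableSet_lt measurable_const (measurable_maxBirkhoffSum hT.measurable hg n))
    hmono hgi.integrableOn
  have huniv : (⋃ n, {x | 0 < maxBirkhoffSum T g n x}) =ᵐ[μ] univ := by
    rw [eventuallyEq_univ]
    filter_upwards [h] with x ⟨n, hn⟩
    exact mem_iUnion.2 ⟨n, hn.trans_le (birkhoffSum_le_maxBirkhoffSum n x)⟩
  rw [setIntegral_congr_set huniv, setIntegral_univ] at hlim
  exact ge_of_tendsto' hlim fun n => setIntegral_maxBirkhoffSum_pos_nonneg hT hg hgi n

/-- If `g` has negative integral and `T` is ergodic, the Birkhoff sums are bounded above. -/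
lemma ae_exists_forall_birkhoffSum_le [IsProbabilityMeasure μ] (hT : Ergodic T μ)
    (hg : Measurable g) (hgi : Integrable g μ) (hneg : ∫ x, g x ∂μ < 0) :
    ∀ᵐ x ∂μ, ∃ K : ℝ, ∀ n, birkhoffSum T g n x ≤ K := by
  -- The event of unbounded sums is strictly invariant, hence null or conull; being conull would
  -- contradict the maximal inequality.
  set B : Set α := {x | ∀ K : ℕ, ∃ n, (K : ℝ) < birkhoffSum T g n x} with hB
  have hmeas (n : ℕ) : Measurable (birkhoffSum T g n) := by
    unfold birkhoffSum
    exact Finset.measurable_fun_sum _ fun i _ => hg.comp (hT.measurable.iterate i)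
  have hBm : MeasurableSet B := by
    have : B = ⋂ K : ℕ, ⋃ n : ℕ, {x | (K : ℝ) < birkhoffSum T g n x} := by
      ext x; simp [hB]
    rw [this]
    exact MeasurableSet.iInter fun K => MeasurableSet.iUnion fun n =>
      measurableSet_lt measurable_const (hmeas n)
  have hBT : T ⁻¹' B = B := by
    ext x
    simp only [hB, mem_preimage, mem_ofPred_eq]
    constructor
    · intro h K
      obtain ⟨K', hK'⟩ := exists_nat_ge ((K : ℝ) - g x)
      obtain ⟨n, hn⟩ := h K'
      exact ⟨n + 1, by rw [birkhoffSum_succ']; linarith⟩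
    · intro h K
      -- The maximum with `0` rules out `n = 0`, so that a first term can be removed from the sum.
      obtain ⟨K', hK'⟩ := exists_nat_ge (max 0 ((K : ℝ) + g x))
      obtain ⟨n, hn⟩ := h K'
      have h0 := (le_max_left _ _).trans hK'
      have h1 := (le_max_right _ _).trans hK'
      cases n with
      | zero => rw [birkhoffSum_zero] at hn; linarith
      | succ n => exact ⟨n, by rw [birkhoffSum_succ'] at hn; linarith⟩
  rcases hT.toPreErgodic.ae_mem_or_ae_notMem hBm hBT with h | h
  · refine absurd (integral_nonneg_of_exists_birkhoffSum_pos hT.toMeasurePreserving hg hgi ?_)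
      (not_le.2 hneg)
    filter_upwards [h] with x hx
    obtain ⟨n, hn⟩ := hx 0
    exact ⟨n, by simpa using hn⟩
  · filter_upwards [h] with x hx
    simp only [hB, mem_ofPred_eq, not_forall, not_exists, not_lt] at hx
    exact ⟨_, hx.choose_spec⟩

/-- For `d` strictly between the integral and `c`, the sums of `g - d` stay below some `K`, and `n *
d + K < n * c` once `n > K / (c - d)`. -/
lemma ae_eventually_birkhoffAverage_le [IsProbabilityMeasure μ] (hT : Ergodic T μ)
    (hg : Measurable g) (hgi : Integrable g μ) {c : ℝ} (hc : ∫ x, g x ∂μ < c) :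
    ∀ᵐ x ∂μ, ∀ᶠ n : ℕ in atTop, birkhoffAverage ℝ T g n x < c := by
  obtain ⟨d, hgd, hdc⟩ := exists_between hc
  have hneg : ∫ x, (g x - d) ∂μ < 0 := by
    rw [integral_sub hgi (integrable_const _)]
    simpa using hgd
  filter_upwards [ae_exists_forall_birkhoffSum_le hT (hg.sub_const d)
    (hgi.sub (integrable_const d)) hneg] with x ⟨K, hK⟩
  obtain ⟨N, hN⟩ := exists_nat_gt (K / (c - d))
  filter_upwards [eventually_gt_atTop N, eventually_gt_atTop 0] with n hn hn0
  have hn0' : (0 : ℝ) < n := by exact_mod_cast hn0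
  have hsum : birkhoffSum T (fun y => g y - d) n x = birkhoffSum T g n x - n * d := by
    simp [birkhoffSum]
  have hKn := hK n
  rw [hsum] at hKn
  have hNn : K / (c - d) < n := hN.trans (by exact_mod_cast hn)
  rw [div_lt_iff₀ (by linarith)] at hNn
  rw [birkhoffAverage, smul_eq_mul, inv_mul_lt_iff₀ hn0']
  linarith

lemma ae_tendsto_birkhoffAverage_of_measurable [IsProbabilityMeasure μ] (hT : Ergodic T μ)
    (hg : Measurable g) (hgi : Integrable g μ) :
    ∀ᵐ x ∂μ, Tendsto (fun n => birkhoffAverage ℝ T g n x) atTop (𝓝 (∫ y, g y ∂μ)) := by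
  have hpos : ∀ k : ℕ, (0 : ℝ) < 1 / ((k : ℝ) + 1) := fun k => Nat.one_div_pos_of_nat
  have h1 := ae_all_iff.2 fun k : ℕ => ae_eventually_birkhoffAverage_le hT hg hgi
    (lt_add_of_pos_right (∫ y, g y ∂μ) (hpos k))
  have h2 := ae_all_iff.2 fun k : ℕ => ae_eventually_birkhoffAverage_le hT hg.neg hgi.neg
    (lt_add_of_pos_right (∫ y, (-g) y ∂μ) (hpos k))
  filter_upwards [h1, h2] with x hx1 hx2
  rw [Metric.tendsto_nhds]
  intro ε hε
  obtain ⟨k, hk⟩ := exists_nat_one_div_lt hε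
  filter_upwards [hx1 k, hx2 k] with n hn1 hn2
  have hneg : birkhoffAverage ℝ T (-g) n x = -birkhoffAverage ℝ T g n x := by
    simp [birkhoffAverage, birkhoffSum_neg]
  rw [hneg] at hn2
  simp only [Pi.neg_apply, integral_neg] at hn2
  rw [Real.dist_eq, abs_lt]
  constructor <;> linarith

/-- Birkhoff's pointwise ergodic theorem, for an ergodic probability-preserving map. -/
theorem ae_tendsto_birkhoffAverage [IsProbabilityMeasure μ] (hT : Ergodic T μ)
    (hgi : Integrable g μ) :
    ∀ᵐ x ∂μ, Tendsto (fun n => birkhoffAverage ℝ T g n x) atTop (𝓝 (∫ y, g y ∂μ)) := by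
  have hae := hgi.1.ae_eq_mk
  have hall : ∀ᵐ x ∂μ, ∀ i : ℕ, g (T^[i] x) = hgi.1.mk g (T^[i] x) :=
    ae_all_iff.2 fun i => (hT.toMeasurePreserving.iterate i).quasiMeasurePreserving.ae_eq_comp hae
  filter_upwards [hall, ae_tendsto_birkhoffAverage_of_measurable hT
    hgi.1.stronglyMeasurable_mk.measurable (hgi.congr hae)] with x hx hlim
  rw [integral_congr_ae hae]
  refine hlim.congr fun n => ?_
  simp only [birkhoffAverage, birkhoffSum, hx]

/-- The mean ergodic theorem in `L¹`, for an ergodic probability-preserving map. -/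
theorem tendsto_eLpNorm_birkhoffAverage [IsProbabilityMeasure μ] (hT : Ergodic T μ)
    (hgi : Integrable g μ) :
    Tendsto (fun n : ℕ => eLpNorm (fun x => birkhoffAverage ℝ T g n x - ∫ y, g y ∂μ) 1 μ)
      atTop (𝓝 0) := by
  have hiter (i : ℕ) : MeasurePreserving T^[i] μ μ := hT.toMeasurePreserving.iterate i
  have hident : ∀ i : ℕ, ProbabilityTheory.IdentDistrib (g ∘ T^[i]) (g ∘ T^[0]) μ μ := by
    intro i
    refine ⟨hgi.1.aemeasurable.comp_quasiMeasurePreserving (hiter i).quasiMeasurePreserving,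
      hgi.1.aemeasurable, ?_⟩
    rw [← AEMeasurable.map_map_of_aemeasurable (by rw [(hiter i).map_eq]; exact hgi.1.aemeasurable)
      (hiter i).aemeasurable, (hiter i).map_eq]
    rfl
  -- The functions `g ∘ T^[i]` are identically distributed, so they and their averages are uniformly
  -- integrable, and Vitali's theorem upgrades almost sure convergence to `L¹`.
  have hui := uniformIntegrable_average le_rfl
    (ProbabilityTheory.MemLp.uniformIntegrable_of_identDistrib (j := 0) le_rfl ENNReal.one_ne_top
      (memLp_one_iff_integrable.2 hgi) hident)
  have heq : ∀ (n : ℕ) (x : α), ((n : ℝ)⁻¹ • ∑ i ∈ Finset.range n, g ∘ T^[i]) x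
      = birkhoffAverage ℝ T g n x := by
    intro n x
    simp [birkhoffAverage, birkhoffSum, Finset.sum_apply]
  refine (tendsto_Lp_finite_of_tendsto_ae (g := fun _ => ∫ y, g y ∂μ) le_rfl ENNReal.one_ne_top
    hui.1 (memLp_const _) hui.unifIntegrable ?_).congr fun n => ?_
  · filter_upwards [ae_tendsto_birkhoffAverage hT hgi] with x hx
    simpa only [heq] using hx
  · congr 1
    ext x
    simp only [Pi.sub_apply, heq]

end Birkhoff

/-! ### Splitting a sum into residue classes modulo `q`. -/

section Residues

/-- The number of `k` with `q * k + r < n`, for `r < q`. -/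
def residueCount (q r n : ℕ) : ℕ := (n + q - 1 - r) / q

lemma lt_residueCount_iff {q r n k : ℕ} (hr : r < q) :
    k < residueCount q r n ↔ q * k + r < n := by
  rw [residueCount, ← Nat.succ_le_iff, Nat.le_div_iff_mul_le (by omega), Nat.succ_mul, mul_comm q k]
  generalize k * q = x
  omega

lemma sum_range_eq_sum_residues {q : ℕ} (hq : 0 < q) (a : ℕ → ℝ) (n : ℕ) :
    ∑ i ∈ Finset.range n, a i =
      ∑ r ∈ Finset.range q, ∑ k ∈ Finset.range (residueCount q r n), a (q * k + r) := by
  rw [← Finset.sum_fiberwise_of_maps_to (t := Finset.range q) (g := fun i => i % q)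
    fun i _ => Finset.mem_range.2 (Nat.mod_lt i hq)]
  refine Finset.sum_congr rfl fun r hr => ?_
  have hr' := Finset.mem_range.1 hr
  refine Finset.sum_nbij' (fun i => i / q) (fun k => q * k + r) ?_ ?_ ?_ ?_ ?_
  · intro i hi
    obtain ⟨h1, h2⟩ := Finset.mem_filter.1 hi
    rw [Finset.mem_range, lt_residueCount_iff hr', ← h2, Nat.div_add_mod]
    exact Finset.mem_range.1 h1
  · intro k hk
    rw [Finset.mem_range, lt_residueCount_iff hr'] at hk
    exact Finset.mem_filter.2 ⟨Finset.mem_range.2 hk, by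
      rw [Nat.mul_add_mod, Nat.mod_eq_of_lt hr']⟩
  · intro i hi
    have h2 := (Finset.mem_filter.1 hi).2
    change q * (i / q) + r = i
    rw [← h2, Nat.div_add_mod]
  · intro k _
    rw [Nat.mul_add_div hq, Nat.div_eq_of_lt hr', add_zero]
  · intro i hi
    have h2 := (Finset.mem_filter.1 hi).2
    change a i = a (q * (i / q) + r)
    rw [← h2, Nat.div_add_mod]

lemma tendsto_residueCount_atTop {q r : ℕ} (hr : r < q) :
    Tendsto (residueCount q r) atTop atTop := by
  refine tendsto_atTop.2 fun k => ?_
  filter_upwards [eventually_gt_atTop (q * k + r)] with n hn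
  exact ((lt_residueCount_iff hr).2 hn).le

/-- `q * residueCount q r n` differs from `n` by at most `q`, so the error is at most `1 / n`. -/
lemma tendsto_residueCount_div {q r : ℕ} (hr : r < q) :
    Tendsto (fun n => (residueCount q r n : ℝ) / n) atTop (𝓝 (1 / q)) := by
  have hq : (0 : ℝ) < q := by exact_mod_cast (by omega : 0 < q)
  rw [tendsto_iff_dist_tendsto_zero]
  refine squeeze_zero' (Eventually.of_forall fun _ => dist_nonneg) ?_
    (tendsto_const_nhds.div_atTop tendsto_natCast_atTop_atTop : Tendsto (fun n : ℕ => (1 : ℝ) / n)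
      atTop (𝓝 0))
  filter_upwards [eventually_gt_atTop 0] with n hn
  have hn' : (0 : ℝ) < n := by exact_mod_cast hn
  have h1 : q * residueCount q r n ≤ n + q :=
    (Nat.mul_div_le (n + q - 1 - r) q).trans (by omega)
  have h2 : n ≤ q * residueCount q r n + q := by
    have := mt (lt_residueCount_iff (n := n) (k := residueCount q r n) hr).2 (lt_irrefl _)
    omega
  have h1' : (q : ℝ) * residueCount q r n ≤ n + q := by exact_mod_cast h1
  have h2' : (n : ℝ) ≤ q * residueCount q r n + q := by exact_mod_cast h2
  have heq : (residueCount q r n : ℝ) / n - 1 / q = (q * residueCount q r n - n) / q / n := by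
    field_simp
  rw [Real.dist_eq, heq, abs_div, abs_of_pos hn']
  refine div_le_div_of_nonneg_right ?_ hn'.le
  rw [abs_div, abs_of_pos hq, div_le_one hq, abs_le]
  constructor <;> linarith

end Residues

/-! ### Ergodic theorems for interlaced orbits. -/

section PeriodicBirkhoff

variable {α : Type*} [MeasurableSpace α] {μ : Measure α} {T : α → α} {X : ℕ → α → ℝ} {q : ℕ}

-- Each residue class contributes a genuine Birkhoff average of `T`, with a weight tending to `1 /
-- q`.
omit [MeasurableSpace α] in
lemma average_eq_sum_birkhoffAverage (hq : 0 < q)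
    (hX : ∀ k, ∀ r < q, ∀ x, X (q * k + r) x = X r (T^[k] x)) (n : ℕ) (x : α) :
    (1 / (n : ℝ)) * ∑ i ∈ Finset.range n, X i x = ∑ r ∈ Finset.range q,
      ((residueCount q r n : ℝ) / n) * birkhoffAverage ℝ T (X r) (residueCount q r n) x := by
  rw [sum_range_eq_sum_residues hq (fun i => X i x), Finset.mul_sum]
  refine Finset.sum_congr rfl fun r hr => ?_
  rw [birkhoffAverage, birkhoffSum, smul_eq_mul,
    Finset.sum_congr rfl fun k _ => hX k r (Finset.mem_range.1 hr) x]
  rcases Nat.eq_zero_or_pos (residueCount q r n) with h | h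
  · simp [h]
  · have : (residueCount q r n : ℝ) ≠ 0 := by exact_mod_cast h.ne'
    field_simp

variable [IsProbabilityMeasure μ]

/-- The pointwise ergodic theorem for the union of finitely many interlaced stationary sequences. -/
lemma ae_tendsto_average_of_periodic (hT : Ergodic T μ) (hq : 0 < q)
    (hXi : ∀ r < q, Integrable (X r) μ)
    (hX : ∀ k, ∀ r < q, ∀ x, X (q * k + r) x = X r (T^[k] x)) :
    ∀ᵐ x ∂μ, Tendsto (fun n : ℕ => (1 / (n : ℝ)) * ∑ i ∈ Finset.range n, X i x) atTop
      (𝓝 ((1 / (q : ℝ)) * ∑ r ∈ Finset.range q, ∫ y, X r y ∂μ)) := by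
  have h : ∀ᵐ x ∂μ, ∀ r ∈ Finset.range q,
      Tendsto (fun n => birkhoffAverage ℝ T (X r) n x) atTop (𝓝 (∫ y, X r y ∂μ)) :=
    (Finset.eventually_all _).2 fun r hr =>
      ae_tendsto_birkhoffAverage hT (hXi r (Finset.mem_range.1 hr))
  filter_upwards [h] with x hx
  simp_rw [average_eq_sum_birkhoffAverage hq hX, Finset.mul_sum]
  refine tendsto_finsetSum _ fun r hr => ?_
  have hr' := Finset.mem_range.1 hr
  exact (tendsto_residueCount_div hr').mul ((hx r hr).comp (tendsto_residueCount_atTop hr'))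

/-- The `L¹` ergodic theorem for the union of finitely many interlaced stationary sequences. -/
lemma tendsto_eLpNorm_average_of_periodic (hT : Ergodic T μ) (hq : 0 < q)
    (hXi : ∀ r < q, Integrable (X r) μ)
    (hX : ∀ k, ∀ r < q, ∀ x, X (q * k + r) x = X r (T^[k] x)) :
    Tendsto (fun n : ℕ => eLpNorm (fun x => (1 / (n : ℝ)) * ∑ i ∈ Finset.range n, X i x -
      (1 / (q : ℝ)) * ∑ r ∈ Finset.range q, ∫ y, X r y ∂μ) 1 μ) atTop (𝓝 0) := by
  let I : ℕ → ℝ := fun r => ∫ y, X r y ∂μ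
  let c : ℕ → ℕ → ℝ := fun r n => (residueCount q r n : ℝ) / n
  let D : ℕ → ℕ → α → ℝ := fun r n x =>
    birkhoffAverage ℝ T (X r) (residueCount q r n) x - I r
  have hbi : ∀ r < q, ∀ n, Integrable (birkhoffAverage ℝ T (X r) n) μ := by
    intro r hr n
    unfold birkhoffAverage birkhoffSum
    exact Integrable.smul (n : ℝ)⁻¹ (integrable_finsetSum _ fun k _ =>
      (hT.toMeasurePreserving.iterate k).integrable_comp_of_integrable (hXi r hr))
  -- Per residue class, one term is the ergodic error and the other the error of the weight.
  have hbound : ∀ n : ℕ, eLpNorm (fun x => (1 / (n : ℝ)) * ∑ i ∈ Finset.range n, X i x -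
      (1 / (q : ℝ)) * ∑ r ∈ Finset.range q, I r) 1 μ ≤
      ∑ r ∈ Finset.range q, (‖c r n‖ₑ * eLpNorm (D r n) 1 μ + ‖(c r n - 1 / q) * I r‖ₑ) := by
    intro n
    have heq : (fun x => (1 / (n : ℝ)) * ∑ i ∈ Finset.range n, X i x -
        (1 / (q : ℝ)) * ∑ r ∈ Finset.range q, I r) =
        ∑ r ∈ Finset.range q, (c r n • D r n + fun _ => (c r n - 1 / q) * I r) := by
      ext x
      rw [average_eq_sum_birkhoffAverage hq hX, Finset.mul_sum, ← Finset.sum_sub_distrib,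
        Finset.sum_apply]
      refine Finset.sum_congr rfl fun r _ => ?_
      simp only [c, D, Pi.add_apply, Pi.smul_apply, smul_eq_mul]
      ring
    have hDm : ∀ r ∈ Finset.range q, AEStronglyMeasurable (c r n • D r n) μ := fun r hr =>
      (((hbi r (Finset.mem_range.1 hr) _).sub (integrable_const _)).smul _).1
    rw [heq]
    refine (eLpNorm_sum_le (fun r hr => (hDm r hr).add aestronglyMeasurable_const) le_rfl).trans
      (Finset.sum_le_sum fun r hr => ?_)
    refine (eLpNorm_add_le (hDm r hr) aestronglyMeasurable_const le_rfl).trans ?_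
    rw [eLpNorm_const_smul, eLpNorm_const' _ one_ne_zero ENNReal.one_ne_top]
    simp
  refine tendsto_of_tendsto_of_tendsto_of_le_of_le tendsto_const_nhds ?_
    (fun _ => zero_le) hbound
  rw [← Finset.sum_const_zero (s := Finset.range q)]
  refine tendsto_finsetSum _ fun r hr => ?_
  have hr' := Finset.mem_range.1 hr
  have hc : Tendsto (c r) atTop (𝓝 (1 / q)) := tendsto_residueCount_div hr'
  have h1 : Tendsto (fun n => ‖c r n‖ₑ * eLpNorm (D r n) 1 μ) atTop (𝓝 (‖(1 / q : ℝ)‖ₑ * 0)) :=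
    ENNReal.Tendsto.mul hc.enorm (Or.inr ENNReal.zero_ne_top)
      ((tendsto_eLpNorm_birkhoffAverage hT (hXi r hr')).comp (tendsto_residueCount_atTop hr'))
      (Or.inr enorm_ne_top)
  have h2 : Tendsto (fun n => ‖(c r n - 1 / q) * I r‖ₑ) atTop
      (𝓝 ‖((1 / q : ℝ) - 1 / q) * I r‖ₑ) := ((hc.sub_const _).mul_const _).enorm
  simpa using h1.add h2

end PeriodicBirkhoff

/-! ### Windows along a staircase, and rational slopes. -/

section Windows

variable {Υ : Type*}

/-- The integer part of `lam * i + t` splits off the height, and its fractional part becomes the new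
intercept. -/
lemma stair_add (lam t : ℝ) (i j : ℤ) :
    stair lam t (i + j) = stair lam (Int.fract (t + lam * i)) j + stair lam t i := by
  refine Prod.ext (add_comm i j) ?_
  change ⌊lam * ((i + j : ℤ) : ℝ) + t⌋ =
    ⌊lam * j + Int.fract (t + lam * i)⌋ + ⌊lam * (i : ℝ) + t⌋
  rw [add_comm (lam * (i : ℝ)) t, ← Int.floor_add_intCast, add_assoc, Int.fract_add_floor]
  congr 1
  push_cast
  ring

/-- A window far along the staircase is an initial window, seen from its starting point. -/
lemma window_eq_window_shift (lam t : ℝ) (m i : ℕ) (ω : Config Υ) :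
    window lam t m i ω = window lam (Int.fract (t + lam * i)) m 0 (shift (stair lam t i) ω) := by
  ext j
  change ω _ = ω _
  rw [stair_add, Int.cast_natCast]
  simp

lemma shift_iterate (v : ℤ × ℤ) (k : ℕ) (ω : Config Υ) : (shift v)^[k] ω = shift (k • v) ω := by
  induction k generalizing ω with
  | zero => ext j; simp [shift]
  | succ k ih =>
    rw [Function.iterate_succ_apply, ih]
    ext j
    simp only [shift, succ_nsmul, add_assoc]

/-- The outer fractional part is needed at `ν = 0`, where `t` has not yet been reduced modulo `1`.
-/
lemma fract_rotation_iterate (lam t : ℝ) (ν : ℕ) :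
    Int.fract ((rotation lam)^[ν] t) = Int.fract (t + lam * ν) := by
  induction ν with
  | zero => simp
  | succ ν ih =>
    rw [Function.iterate_succ_apply', rotation, Int.fract_fract, Int.fract_eq_fract]
    obtain ⟨z, hz⟩ := Int.fract_eq_fract.1 ih
    refine ⟨z, ?_⟩
    push_cast
    linarith

/-- An integer `k` lies below the height iff the integer `q * k - p * z` is at most `q * t`,
equivalently at most `⌊q * t⌋`. -/
lemma stair_rational (p : ℤ) {q : ℕ} (hq : 0 < q) (t : ℝ) (z : ℤ) :
    stair ((p : ℝ) / q) t z = stair ((p : ℝ) / q) ((⌊(q : ℝ) * t⌋ : ℝ) / q) z := by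
  have hq' : (0 : ℝ) < q := by exact_mod_cast hq
  refine Prod.ext rfl (eq_of_forall_le_iff fun k => ?_)
  change k ≤ ⌊_⌋ ↔ k ≤ ⌊_⌋
  have h : q * k - p * z ≤ ⌊(q : ℝ) * t⌋ ↔ ((q * k - p * z : ℤ) : ℝ) ≤ q * t := Int.le_floor
  have h' : q * k - p * z ≤ ⌊(q : ℝ) * t⌋ ↔ ((q * k - p * z : ℤ) : ℝ) ≤ ⌊(q : ℝ) * t⌋ :=
    Int.cast_le.symm
  have e1 : (p : ℝ) / q * z + t = (p * z + q * t) / q := by field_simp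
  have e2 : (p : ℝ) / q * z + (⌊(q : ℝ) * t⌋ : ℝ) / q = (p * z + ⌊(q : ℝ) * t⌋) / q := by ring
  rw [Int.le_floor, Int.le_floor, e1, e2, le_div_iff₀ hq', le_div_iff₀ hq']
  push_cast at h h'
  constructor
  · intro hk
    linarith [h'.1 (h.2 (by linarith))]
  · intro hk
    linarith [h.1 (h'.2 (by linarith))]

lemma window_rational (p : ℤ) {q : ℕ} (hq : 0 < q) (t : ℝ) (m : ℕ) :
    window (Υ := Υ) ((p : ℝ) / q) t m = window ((p : ℝ) / q) ((⌊(q : ℝ) * t⌋ : ℝ) / q) m := by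
  ext i ω j
  rw [window, stair_rational p hq]
  rfl

lemma window_rational_periodic (p : ℤ) {q : ℕ} (hq : 0 < q) (t : ℝ) (m k r : ℕ) (ω : Config Υ) :
    window ((p : ℝ) / q) t m (q * k + r) ω =
      window ((p : ℝ) / q) t m r ((shift ((q : ℤ), p))^[k] ω) := by
  have hq' : (q : ℝ) ≠ 0 := by exact_mod_cast hq.ne'
  rw [shift_iterate]
  ext j
  change ω _ = ω _
  congr 1
  refine Prod.ext ?_ ?_
  · change ((q * k + r : ℕ) : ℤ) + ((j : ℕ) : ℤ) = ((r : ℤ) + ((j : ℕ) : ℤ)) + k • (q : ℤ)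
    rw [nsmul_eq_mul]
    push_cast
    ring
  · change ⌊(p : ℝ) / q * (((q * k + r : ℕ) : ℤ) + ((j : ℕ) : ℤ) : ℤ) + t⌋ =
      ⌊(p : ℝ) / q * ((r : ℤ) + ((j : ℕ) : ℤ) : ℤ) + t⌋ + k • p
    rw [nsmul_eq_mul, ← Int.floor_add_intCast]
    congr 1
    push_cast
    field_simp
    ring

/-- Every rational staircase with intercept in `[0, 1]` has an intercept among finitely many. -/
lemma exists_rational_intercept (p : ℤ) {q : ℕ} (hq : 0 < q) {t : ℝ} (ht : t ∈ Icc (0 : ℝ) 1)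
    (m : ℕ) : ∃ k ∈ Finset.range (q + 1),
      window (Υ := Υ) ((p : ℝ) / q) t m = window ((p : ℝ) / q) ((k : ℝ) / q) m := by
  have hq' : (0 : ℝ) < q := by exact_mod_cast hq
  have h0 : 0 ≤ ⌊(q : ℝ) * t⌋ := Int.floor_nonneg.2 (mul_nonneg hq'.le ht.1)
  have h1 : ⌊(q : ℝ) * t⌋ ≤ q := by
    have : (q : ℝ) * t ≤ q := mul_le_of_le_one_right hq'.le ht.2
    exact_mod_cast (Int.floor_le _).trans this
  obtain ⟨k, hk⟩ := Int.eq_ofNat_of_zero_le h0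
  -- The value `k = q` occurs for `t = 1`, whence `q + 1` intercepts.
  refine ⟨k, Finset.mem_range.2 (by omega), ?_⟩
  rw [window_rational p hq t m, hk]
  simp

variable [MeasurableSpace Υ] {P : Measure (Config Υ)}

lemma measurable_window (lam t : ℝ) (m i : ℕ) : Measurable (window (Υ := Υ) lam t m i) :=
  measurable_pi_iff.2 fun _ => measurable_pi_apply _

lemma map_window (hP : IsStationary P) (lam t : ℝ) (m i : ℕ) :
    P.map (window lam t m i) = windowLaw P lam (Int.fract (t + lam * i)) m := by
  have : window (Υ := Υ) lam t m i =
      window lam (Int.fract (t + lam * i)) m 0 ∘ shift (stair lam t i) :=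
    funext fun ω => window_eq_window_shift lam t m i ω
  rw [this, ← Measure.map_map (measurable_window _ _ _ _) (hP _).measurable, (hP _).map_eq]
  rfl

lemma windowLaw_fract (hP : IsStationary P) (lam t : ℝ) (m : ℕ) :
    windowLaw P lam (Int.fract t) m = windowLaw P lam t m := by
  have := map_window hP lam t m 0
  rw [Nat.cast_zero, mul_zero, add_zero] at this
  exact this.symm

lemma windowLaw_rotation_iterate (hP : IsStationary P) (lam t : ℝ) (m ν : ℕ) :
    windowLaw P lam ((rotation lam)^[ν] t) m = P.map (window lam t m ν) := by
  rw [map_window hP, ← windowLaw_fract hP, fract_rotation_iterate]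

variable {m : ℕ} {lam : ℝ} {f : (Fin m → Υ) → ℝ}

lemma integrable_window (hP : IsStationary P)
    (hf : ∀ t ∈ Icc (0 : ℝ) 1, Integrable f (windowLaw P lam t m)) (t : ℝ) (i : ℕ) :
    Integrable (fun ω => f (window lam t m i ω)) P := by
  have h := hf _ ⟨Int.fract_nonneg (t + lam * i), (Int.fract_lt_one _).le⟩
  rw [← map_window hP] at h
  exact h.comp_measurable (measurable_window lam t m i)

lemma integral_windowLaw_rotation_iterate (hP : IsStationary P)
    (hf : ∀ t ∈ Icc (0 : ℝ) 1, Integrable f (windowLaw P lam t m)) (t : ℝ) (ν : ℕ) :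
    ∫ y, f y ∂(windowLaw P lam ((rotation lam)^[ν] t) m) = ∫ ω, f (window lam t m ν ω) ∂P := by
  have h := hf _ ⟨Int.fract_nonneg (t + lam * ν), (Int.fract_lt_one _).le⟩
  rw [← map_window hP] at h
  rw [windowLaw_rotation_iterate hP, integral_map (measurable_window lam t m ν).aemeasurable h.1]

lemma integrable_stairAverage (hP : IsStationary P)
    (hf : ∀ t ∈ Icc (0 : ℝ) 1, Integrable f (windowLaw P lam t m)) (t : ℝ) (n : ℕ) :
    Integrable (stairAverage f lam t n) P :=
  (integrable_finsetSum _ fun i _ => integrable_window hP hf t i).const_mul _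

variable [IsProbabilityMeasure P]

lemma tendsto_stairAverage_rational (hP : IsStationary P)
    (hf : ∀ t ∈ Icc (0 : ℝ) 1, Integrable f (windowLaw P lam t m)) (p : ℤ) {q : ℕ} (hq : 0 < q)
    (hlam : lam = (p : ℝ) / q) (herg : Ergodic (shift ((q : ℤ), p)) P) :
    Tendsto (fun n : ℕ => ⨆ t ∈ Icc (0 : ℝ) 1,
        eLpNorm (fun ω => stairAverage f lam t n ω - (1 / (q : ℝ)) * ∑ ν ∈ Finset.range q,
          ∫ y, f y ∂(windowLaw P lam ((rotation lam)^[ν] t) m)) 1 P) atTop (𝓝 0) ∧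
      ∀ᵐ ω ∂P, TendstoUniformlyOn (fun (n : ℕ) (t : ℝ) => stairAverage f lam t n ω)
        (fun t : ℝ => (1 / (q : ℝ)) * ∑ ν ∈ Finset.range q,
          ∫ y, f y ∂(windowLaw P lam ((rotation lam)^[ν] t) m)) atTop (Icc (0 : ℝ) 1) := by
  simp_rw [integral_windowLaw_rotation_iterate hP hf]
  have hXi (t : ℝ) : ∀ r < q, Integrable (fun ω => f (window lam t m r ω)) P :=
    fun r _ => integrable_window hP hf t r
  have hX (t : ℝ) : ∀ k, ∀ r < q, ∀ ω, f (window lam t m (q * k + r) ω) =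
      f (window lam t m r ((shift ((q : ℤ), p))^[k] ω)) := by
    intro k r _ ω
    rw [hlam, window_rational_periodic p hq]
  constructor
  · rw [ENNReal.tendsto_nhds_zero]
    intro ε hε
    have hfin : ∀ᶠ n : ℕ in atTop, ∀ k ∈ Finset.range (q + 1),
        eLpNorm (fun ω => stairAverage f lam ((k : ℝ) / q) n ω - (1 / (q : ℝ)) *
          ∑ ν ∈ Finset.range q, ∫ ω, f (window lam ((k : ℝ) / q) m ν ω) ∂P) 1 P ≤ ε :=
      (Finset.eventually_all _).2 fun k _ => ENNReal.tendsto_nhds_zero.1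
        (tendsto_eLpNorm_average_of_periodic herg hq (hXi _) (hX _)) ε hε
    filter_upwards [hfin] with n hn
    refine iSup₂_le fun t ht => ?_
    obtain ⟨k, hk, hw⟩ := exists_rational_intercept (Υ := Υ) p hq ht m
    have := hn k hk
    simp only [stairAverage, hlam, hw] at this ⊢
    exact this
  · have hfin : ∀ᵐ ω ∂P, ∀ k ∈ Finset.range (q + 1),
        Tendsto (fun n : ℕ => stairAverage f lam ((k : ℝ) / q) n ω) atTop (𝓝 ((1 / (q : ℝ)) *
          ∑ ν ∈ Finset.range q, ∫ ω, f (window lam ((k : ℝ) / q) m ν ω) ∂P)) :=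
      (Finset.eventually_all _).2 fun k _ =>
        ae_tendsto_average_of_periodic herg hq (hXi _) (hX _)
    filter_upwards [hfin] with ω hω
    rw [Metric.tendstoUniformlyOn_iff]
    intro ε hε
    have hev := (Finset.eventually_all _).2 fun k hk => Metric.tendsto_nhds.1 (hω k hk) ε hε
    filter_upwards [hev] with n hn t ht
    obtain ⟨k, hk, hw⟩ := exists_rational_intercept (Υ := Υ) p hq ht m
    have := hn k hk
    rw [dist_comm]
    simp only [stairAverage, hlam, hw] at this ⊢
    exact this

end Windows

/-! ### Uniform `L¹` averaging under strong mixing. -/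

section Mixing

variable {Υ : Type*}

lemma shift_shift (u v : ℤ × ℤ) (ω : Config Υ) : shift u (shift v ω) = shift (u + v) ω := by
  ext j
  simp only [shift, add_assoc]

variable [MeasurableSpace Υ] {P : Measure (Config Υ)}

/-- The centred sum of `h` over the translates by `w i`, `i ∈ S`, divided by `n`. -/
def centredAverage (P : Measure (Config Υ)) (h : Config Υ → ℝ) (n : ℕ) (w : ℕ → ℤ × ℤ)
    (S : Finset ℕ) (ω : Config Υ) : ℝ :=
  (n : ℝ)⁻¹ * ∑ i ∈ S, (h (shift (w i) ω) - ∫ ω', h ω' ∂P)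

/-- The centred averages of `h` tend to zero in `L¹`, uniformly over all sets of indices and all
sequences of translations advancing at unit speed in the first coordinate. -/
def UniformlyAveraging (P : Measure (Config Υ)) (h : Config Υ → ℝ) : Prop :=
  ∀ ε > 0, ∀ᶠ n : ℕ in atTop, ∀ w : ℕ → ℤ × ℤ, (∀ i, (w i).1 = i) →
    ∀ S ⊆ Finset.range n, ∫ ω, |centredAverage P h n w S ω| ∂P ≤ ε

lemma centredAverage_add {g h : Config Υ → ℝ} (hg : Integrable g P) (hh : Integrable h P) (n : ℕ)
    (w : ℕ → ℤ × ℤ) (S : Finset ℕ) (ω : Config Υ) :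
    centredAverage P (g + h) n w S ω = centredAverage P g n w S ω + centredAverage P h n w S ω := by
  simp only [centredAverage, Pi.add_apply]
  rw [integral_add hg hh, ← mul_add, ← Finset.sum_add_distrib]
  congr 1
  exact Finset.sum_congr rfl fun i _ => by ring

lemma centredAverage_const_mul (c : ℝ) (h : Config Υ → ℝ) (n : ℕ)
    (w : ℕ → ℤ × ℤ) (S : Finset ℕ) (ω : Config Υ) :
    centredAverage P (fun x => c * h x) n w S ω = c * centredAverage P h n w S ω := by
  simp only [centredAverage]
  rw [integral_const_mul, mul_left_comm, Finset.mul_sum _ _ c]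
  congr 1
  exact Finset.sum_congr rfl fun i _ => by ring

lemma inv_mul_card_le_one {n : ℕ} {S : Finset ℕ} (hS : S ⊆ Finset.range n) :
    (n : ℝ)⁻¹ * S.card ≤ 1 := by
  have h : (S.card : ℝ) ≤ n := by
    exact_mod_cast (Finset.card_le_card hS).trans_eq (Finset.card_range n)
  rw [inv_mul_eq_div]
  exact div_le_one_of_le₀ h n.cast_nonneg

lemma integral_comp_shift (hP : IsStationary P) {h : Config Υ → ℝ} (hh : AEStronglyMeasurable h P)
    (v : ℤ × ℤ) : ∫ ω, h (shift v ω) ∂P = ∫ ω, h ω ∂P := by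
  conv_rhs => rw [← (hP v).map_eq]
  rw [integral_map (hP v).aemeasurable (by rwa [(hP v).map_eq])]

lemma UniformlyAveraging.const_mul {h : Config Υ → ℝ} (hu : UniformlyAveraging P h) (c : ℝ) :
    UniformlyAveraging P (fun x => c * h x) := by
  intro ε hε
  have hc : 0 < |c| + 1 := by positivity
  filter_upwards [hu (ε / (|c| + 1)) (div_pos hε hc)] with n hn w hw S hS
  simp only [centredAverage_const_mul, abs_mul]
  rw [integral_const_mul]
  have h0 : 0 ≤ ∫ ω, |centredAverage P h n w S ω| ∂P := integral_nonneg fun _ => abs_nonneg _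
  have h1 := (le_div_iff₀ hc).1 (hn w hw S hS)
  nlinarith

variable [IsProbabilityMeasure P]

lemma integrable_centredAverage (hP : IsStationary P) {h : Config Υ → ℝ} (hh : Integrable h P)
    (n : ℕ) (w : ℕ → ℤ × ℤ) (S : Finset ℕ) : Integrable (centredAverage P h n w S) P :=
  (integrable_finsetSum _ fun i _ =>
    ((hP (w i)).integrable_comp_of_integrable hh).sub (integrable_const _)).const_mul _

/-- This bound does not depend on `w`, `S` or `n`; it is what lets the averaging property pass to
`L¹` limits. -/
lemma integral_abs_centredAverage_le (hP : IsStationary P) {h : Config Υ → ℝ}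
    (hh : Integrable h P) {n : ℕ} (w : ℕ → ℤ × ℤ) {S : Finset ℕ} (hS : S ⊆ Finset.range n) :
    ∫ ω, |centredAverage P h n w S ω| ∂P ≤ 2 * ∫ ω, |h ω| ∂P := by
  have hn : (0 : ℝ) ≤ (n : ℝ)⁻¹ := by positivity
  have hi (i : ℕ) : Integrable (fun ω => |h (shift (w i) ω)|) P :=
    (hP (w i)).integrable_comp_of_integrable hh.abs
  have hi' (i : ℕ) : Integrable (fun ω => |h (shift (w i) ω)| + |∫ ω', h ω' ∂P|) P :=
    (hi i).add (integrable_const _)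
  have hI : |∫ ω, h ω ∂P| ≤ ∫ ω, |h ω| ∂P := abs_integral_le_integral_abs
  have h0 : 0 ≤ ∫ ω, |h ω| ∂P := integral_nonneg fun _ => abs_nonneg _
  calc ∫ ω, |centredAverage P h n w S ω| ∂P
      ≤ ∫ ω, (n : ℝ)⁻¹ * ∑ i ∈ S, (|h (shift (w i) ω)| + |∫ ω', h ω' ∂P|) ∂P := by
        refine integral_mono (integrable_centredAverage hP hh n w S).abs
          ((integrable_finsetSum _ fun i _ => (hi i).add (integrable_const _)).const_mul _)
          fun ω => ?_
        simp only [centredAverage]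
        rw [abs_mul, abs_of_nonneg hn]
        exact mul_le_mul_of_nonneg_left ((Finset.abs_sum_le_sum_abs _ _).trans
          (Finset.sum_le_sum fun i _ => abs_sub _ _)) hn
    _ = (n : ℝ)⁻¹ * ∑ i ∈ S, (∫ ω, |h ω| ∂P + |∫ ω', h ω' ∂P|) := by
        rw [integral_const_mul, integral_finsetSum _ fun i _ => hi' i]
        congr 1
        refine Finset.sum_congr rfl fun i _ => ?_
        rw [integral_add (hi i) (integrable_const _), integral_comp_shift hP hh.abs.1]
        simp
    _ = ((n : ℝ)⁻¹ * S.card) * (∫ ω, |h ω| ∂P + |∫ ω', h ω' ∂P|) := by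
        rw [Finset.sum_const, nsmul_eq_mul, mul_assoc]
    _ ≤ 1 * (∫ ω, |h ω| ∂P + |∫ ω', h ω' ∂P|) :=
        mul_le_mul_of_nonneg_right (inv_mul_card_le_one hS) (add_nonneg h0 (abs_nonneg _))
    _ ≤ 2 * ∫ ω, |h ω| ∂P := by linarith

lemma integral_abs_centredAverage_add_le (hP : IsStationary P) {g h : Config Υ → ℝ}
    (hg : Integrable g P) (hh : Integrable h P) (n : ℕ) (w : ℕ → ℤ × ℤ) (S : Finset ℕ) :
    ∫ ω, |centredAverage P (g + h) n w S ω| ∂P ≤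
      ∫ ω, |centredAverage P g n w S ω| ∂P + ∫ ω, |centredAverage P h n w S ω| ∂P := by
  have hgi := integrable_centredAverage hP hg n w S
  have hhi := integrable_centredAverage hP hh n w S
  rw [← integral_add hgi.abs hhi.abs]
  refine integral_mono (integrable_centredAverage hP (hg.add hh) n w S).abs (hgi.abs.add hhi.abs)
    fun ω => ?_
  simp only [centredAverage_add hg hh]
  exact abs_add_le _ _

lemma UniformlyAveraging.add (hP : IsStationary P) {g h : Config Υ → ℝ} (hg : Integrable g P)
    (hh : Integrable h P) (hgu : UniformlyAveraging P g) (hhu : UniformlyAveraging P h) :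
    UniformlyAveraging P (g + h) := by
  intro ε hε
  filter_upwards [hgu (ε / 2) (half_pos hε), hhu (ε / 2) (half_pos hε)] with n h1 h2 w hw S hS
  linarith [integral_abs_centredAverage_add_le hP hg hh n w S, h1 w hw S hS, h2 w hw S hS]

lemma UniformlyAveraging.of_approx (hP : IsStationary P) {h : Config Υ → ℝ} (hh : Integrable h P)
    (happ : ∀ ε > 0, ∃ g, Integrable g P ∧ UniformlyAveraging P g ∧
      ∫ ω, |h ω - g ω| ∂P ≤ ε) : UniformlyAveraging P h := by
  intro ε hε
  obtain ⟨g, hg, hgu, hgh⟩ := happ (ε / 4) (by linarith)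
  filter_upwards [hgu (ε / 2) (half_pos hε)] with n h1 w hw S hS
  have h2 := integral_abs_centredAverage_add_le hP hg (hh.sub hg) n w S
  rw [add_sub_cancel] at h2
  have h3 := integral_abs_centredAverage_le hP (hh.sub hg) w hS
  simp only [Pi.sub_apply] at h3
  linarith [h1 w hw S hS]

/-- The covariance of two translates of an event. -/
lemma integral_centred_indicator_mul (hP : IsStationary P) {A : Set (Config Υ)}
    (hA : MeasurableSet A) (u v : ℤ × ℤ) :
    ∫ ω, (A.indicator 1 (shift u ω) - P.real A) * (A.indicator 1 (shift v ω) - P.real A) ∂P =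
      P.real (A ∩ shift (v - u) ⁻¹' A) - P.real A * P.real A := by
  have hAv : MeasurableSet (A ∩ shift (v - u) ⁻¹' A) := hA.inter ((hP _).measurable hA)
  have hi1 : Integrable (A.indicator (1 : Config Υ → ℝ)) P := (integrable_const 1).indicator hA
  have hint (u : ℤ × ℤ) : Integrable (fun ω => A.indicator (1 : Config Υ → ℝ) (shift u ω)) P :=
    (hP u).integrable_comp_of_integrable hi1
  have hi2 : Integrable ((A ∩ shift (v - u) ⁻¹' A).indicator (1 : Config Υ → ℝ)) P :=
    (integrable_const 1).indicator hAv
  have heq : ∀ ω, (A.indicator (1 : Config Υ → ℝ) (shift u ω) - P.real A) *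
      (A.indicator 1 (shift v ω) - P.real A) =
      (A ∩ shift (v - u) ⁻¹' A).indicator 1 (shift u ω) -
        P.real A * A.indicator 1 (shift u ω) - P.real A * A.indicator 1 (shift v ω) +
        P.real A * P.real A := by
    intro ω
    have hv : shift v ω = shift (v - u) (shift u ω) := by rw [shift_shift, sub_add_cancel]
    have : (A ∩ shift (v - u) ⁻¹' A).indicator (1 : Config Υ → ℝ) (shift u ω) =
        A.indicator 1 (shift u ω) * A.indicator 1 (shift v ω) := by
      rw [inter_indicator_one, hv]
      rfl
    rw [this]
    ring
  have hi3 : Integrable (fun ω => (A ∩ shift (v - u) ⁻¹' A).indicator (1 : Config Υ → ℝ)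
      (shift u ω)) P := (hP u).integrable_comp_of_integrable hi2
  have hi4 := hi3.sub ((hint u).const_mul (P.real A))
  have hi5 := hi4.sub ((hint v).const_mul (P.real A))
  simp only [Pi.sub_def] at hi4 hi5
  simp_rw [heq]
  rw [integral_add hi5 (integrable_const _), integral_sub hi4 ((hint v).const_mul _),
    integral_sub hi3 ((hint u).const_mul _), integral_const_mul, integral_const_mul,
    integral_comp_shift hP hi2.1, integral_comp_shift hP hi1.1, integral_comp_shift hP hi1.1,
    integral_indicator_one hAv, integral_indicator_one hA]
  simp

/-- Mixing leaves only finitely many exceptional `v`, so their first coordinates are bounded. The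
criterion ignores the second coordinate because the translations' heights are arbitrary. -/
lemma exists_forall_abs_covariance_le (hmix : IsStronglyMixing P) {A : Set (Config Υ)}
    (hA : MeasurableSet A) {δ : ℝ} (hδ : 0 < δ) :
    ∃ R : ℕ, ∀ v : ℤ × ℤ, R < v.1.natAbs →
      |P.real (A ∩ shift v ⁻¹' A) - P.real A * P.real A| ≤ δ := by
  have hlim : Tendsto (fun v : ℤ × ℤ => P.real (A ∩ shift v ⁻¹' A)) cofinite
      (𝓝 (P.real A * P.real A)) := by
    rw [measureReal_def, ← ENNReal.toReal_mul]
    exact (ENNReal.tendsto_toReal (ENNReal.mul_ne_top (measure_ne_top _ _)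
      (measure_ne_top _ _))).comp (hmix A A hA hA)
  have hfin := eventually_cofinite.1 (Metric.tendsto_nhds.1 hlim δ hδ)
  obtain ⟨R, hR⟩ := (hfin.image fun v : ℤ × ℤ => v.1.natAbs).bddAbove
  refine ⟨R, fun v hv => ?_⟩
  by_contra hcon
  have hmem : v ∈ {v : ℤ × ℤ | ¬ dist (P.real (A ∩ shift v ⁻¹' A)) (P.real A * P.real A) < δ} :=
    fun hlt => hcon (by rw [Real.dist_eq] at hlt; exact hlt.le)
  exact absurd (hR (mem_image_of_mem _ hmem)) (not_le.2 hv)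

/-- At most `2 * R + 1` indices lie within `R` of `i`, each contributing at most `1`; the at most
`n` others contribute at most `δ` each. -/
lemma sum_abs_covariance_le {n R : ℕ} {S : Finset ℕ} (hS : S ⊆ Finset.range n) (i : ℕ)
    {c : ℕ → ℝ} {δ : ℝ} (hδ : 0 ≤ δ) (hc1 : ∀ j, c j ≤ 1)
    (hc : ∀ j : ℕ, R < ((j : ℤ) - i).natAbs → c j ≤ δ) :
    ∑ j ∈ S, c j ≤ (2 * R + 1) + n * δ := by
  have hcard : ((S.filter fun j : ℕ => ¬ R < ((j : ℤ) - i).natAbs).card : ℝ) ≤ 2 * R + 1 := by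
    have hsub : (S.filter fun j : ℕ => ¬ R < ((j : ℤ) - i).natAbs) ⊆
        Finset.Ico (i - R) (i + R + 1) := by
      intro j hj
      have := (Finset.mem_filter.1 hj).2
      rw [Finset.mem_Ico]
      omega
    have h := Finset.card_le_card hsub
    rw [Nat.card_Ico] at h
    have h' : (S.filter fun j : ℕ => ¬ R < ((j : ℤ) - i).natAbs).card ≤ 2 * R + 1 := by omega
    exact_mod_cast h'
  have hcard' : ((S.filter fun j : ℕ => R < ((j : ℤ) - i).natAbs).card : ℝ) ≤ n := by
    exact_mod_cast (Finset.card_le_card ((Finset.filter_subset _ _).trans hS)).trans_eq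
      (Finset.card_range n)
  rw [← Finset.sum_filter_add_sum_filter_not S (fun j : ℕ => R < ((j : ℤ) - i).natAbs)]
  have h1 := Finset.sum_le_card_nsmul (S.filter fun j : ℕ => R < ((j : ℤ) - i).natAbs) c δ
    fun j hj => hc j (Finset.mem_filter.1 hj).2
  have h2 := Finset.sum_le_card_nsmul (S.filter fun j : ℕ => ¬ R < ((j : ℤ) - i).natAbs) c 1
    fun j _ => hc1 j
  rw [nsmul_eq_mul] at h1 h2
  nlinarith

/-- Second-moment method: each row of the covariance matrix sums to at most `n * ε ^ 2`, so the
centred average has second moment at most `ε ^ 2`. -/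
lemma uniformlyAveraging_indicator (hP : IsStationary P) (hmix : IsStronglyMixing P)
    {A : Set (Config Υ)} (hA : MeasurableSet A) : UniformlyAveraging P (A.indicator 1) := by
  intro ε hε
  obtain ⟨R, hR⟩ := exists_forall_abs_covariance_le hmix hA (δ := ε ^ 2 / 2) (by positivity)
  -- Beyond `N` the near-diagonal count `2 * R + 1` is at most `n * (ε ^ 2 / 2)`, half of the row
  -- budget.
  obtain ⟨N, hN⟩ := exists_nat_gt ((2 * R + 1) / (ε ^ 2 / 2))
  filter_upwards [eventually_ge_atTop N, eventually_gt_atTop 0] with n hn hn0 w hw S hS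
  have hn' : (0 : ℝ) < n := by exact_mod_cast hn0
  have hNn : (2 * R + 1 : ℝ) ≤ n * (ε ^ 2 / 2) := by
    rw [← div_le_iff₀ (by positivity)]
    exact hN.le.trans (by exact_mod_cast hn)
  set Y := centredAverage P (A.indicator 1) n w S with hY
  let X : ℕ → Config Υ → ℝ := fun i ω => A.indicator 1 (shift (w i) ω) - P.real A
  have hYX : ∀ ω, Y ω ^ 2 = ((n : ℝ)⁻¹) ^ 2 * ∑ i ∈ S, ∑ j ∈ S, X i ω * X j ω := by
    intro ω
    rw [← Finset.sum_mul_sum, hY, centredAverage, integral_indicator_one hA]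
    simp only [X]
    ring
  have hi1 : Integrable (A.indicator (1 : Config Υ → ℝ)) P := (integrable_const 1).indicator hA
  have hXi : ∀ i, Integrable (X i) P := fun i =>
    ((hP (w i)).integrable_comp_of_integrable hi1).sub (integrable_const _)
  have hXb : ∀ i, ∀ᵐ ω ∂P, ‖X i ω‖ ≤ 1 := fun i => ae_of_all _ fun ω => by
    have h1 : 0 ≤ P.real A := measureReal_nonneg
    have h2 : P.real A ≤ 1 := measureReal_le_one
    have h3 : 0 ≤ A.indicator (1 : Config Υ → ℝ) (shift (w i) ω) :=
      indicator_nonneg (fun _ _ => zero_le_one) _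
    have h4 : A.indicator (1 : Config Υ → ℝ) (shift (w i) ω) ≤ 1 :=
      indicator_le_self' (f := (1 : Config Υ → ℝ)) (fun _ _ => zero_le_one) _
    rw [Real.norm_eq_abs, abs_le]
    constructor <;> simp only [X] <;> linarith
  have hXX : ∀ i j, Integrable (fun ω => X i ω * X j ω) P := fun i j =>
    (hXi j).bdd_mul (hXi i).1 (hXb i)
  have hYi : Integrable (fun ω => Y ω ^ 2) P := by
    simp_rw [hYX]
    exact (integrable_finsetSum _ fun i _ => integrable_finsetSum _ fun j _ => hXX i j).const_mul _
  have hcov1 : ∀ v : ℤ × ℤ, P.real (A ∩ shift v ⁻¹' A) - P.real A * P.real A ≤ 1 := fun v => by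
    nlinarith [measureReal_le_one (μ := P) (s := A ∩ shift v ⁻¹' A),
      measureReal_nonneg (μ := P) (s := A)]
  have hsq : ∫ ω, Y ω ^ 2 ∂P ≤ ε ^ 2 := by
    simp_rw [hYX]
    rw [integral_const_mul, integral_finsetSum _ fun i _ => integrable_finsetSum _ fun j _ =>
      hXX i j]
    have hrow : ∀ i ∈ S, ∫ ω, ∑ j ∈ S, X i ω * X j ω ∂P ≤ n * ε ^ 2 := by
      intro i _
      rw [integral_finsetSum _ fun j _ => hXX i j]
      simp only [X]
      simp_rw [integral_centred_indicator_mul hP hA]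
      refine (sum_abs_covariance_le hS i (R := R) (δ := ε ^ 2 / 2) (by positivity)
        (fun j => hcov1 _) fun (j : ℕ) hj => ?_).trans (by linarith)
      refine (le_abs_self _).trans (hR _ ?_)
      rwa [Prod.fst_sub, hw, hw]
    have hcard : (S.card : ℝ) ≤ n := by
      exact_mod_cast (Finset.card_le_card hS).trans_eq (Finset.card_range n)
    have hsum := Finset.sum_le_card_nsmul S _ _ hrow
    rw [nsmul_eq_mul] at hsum
    calc ((n : ℝ)⁻¹) ^ 2 * ∑ i ∈ S, ∫ ω, ∑ j ∈ S, X i ω * X j ω ∂P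
        ≤ ((n : ℝ)⁻¹) ^ 2 * (n * (n * ε ^ 2)) :=
          mul_le_mul_of_nonneg_left (hsum.trans (mul_le_mul_of_nonneg_right hcard (by positivity)))
            (by positivity)
      _ = ε ^ 2 := by field_simp
  -- The pointwise inequality `|Y| ≤ Y ^ 2 / (2 * ε) + ε / 2` plays the role of Cauchy–Schwarz.
  calc ∫ ω, |Y ω| ∂P ≤ ∫ ω, (Y ω ^ 2 / (2 * ε) + ε / 2) ∂P := by
        refine integral_mono (integrable_centredAverage hP hi1 n w S).abs
          ((hYi.div_const _).add (integrable_const _)) fun ω => ?_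
        have : Y ω ^ 2 / (2 * ε) + ε / 2 - |Y ω| = (|Y ω| - ε) ^ 2 / (2 * ε) := by
          rw [← sq_abs (Y ω)]
          field_simp
          ring
        have h0 : 0 ≤ (|Y ω| - ε) ^ 2 / (2 * ε) := by positivity
        change |Y ω| ≤ Y ω ^ 2 / (2 * ε) + ε / 2
        linarith
    _ = (∫ ω, Y ω ^ 2 ∂P) / (2 * ε) + ε / 2 := by
        rw [integral_add (hYi.div_const _) (integrable_const _), integral_div]
        simp
    _ ≤ ε ^ 2 / (2 * ε) + ε / 2 := by gcongr
    _ = ε := by field_simp; ring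

/-- Under strong mixing, every integrable function averages out along all such sequences. -/
theorem uniformlyAveraging_of_isStronglyMixing (hP : IsStationary P) (hmix : IsStronglyMixing P)
    {h : Config Υ → ℝ} (hh : Integrable h P) : UniformlyAveraging P h := by
  refine Integrable.induction (UniformlyAveraging P) ?_ ?_ ?_ ?_ hh
  · intro c A hA _
    have heq : A.indicator (fun _ => c) = fun x => c * A.indicator (1 : Config Υ → ℝ) x := by
      ext x
      by_cases hx : x ∈ A <;> simp [hx]
    rw [heq]
    exact (uniformlyAveraging_indicator hP hmix hA).const_mul c
  · intro g h _ hg hh hgu hhu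
    exact hgu.add hP hg hh hhu
  · refine isClosed_of_closure_subset fun F hF => ?_
    refine UniformlyAveraging.of_approx hP (L1.integrable_coeFn F) fun ε hε => ?_
    obtain ⟨G, hG, hFG⟩ := Metric.mem_closure_iff.1 hF ε hε
    refine ⟨G, L1.integrable_coeFn G, hG, ?_⟩
    rw [L1.dist_eq_integral_dist] at hFG
    exact hFG.le
  · intro g h hgh hg hgu
    refine UniformlyAveraging.of_approx hP (hg.congr hgh) fun ε hε => ⟨g, hg, hgu, ?_⟩
    have h0 : (fun ω => |h ω - g ω|) =ᵐ[P] 0 := by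
      filter_upwards [hgh] with ω hω
      simp [hω]
    rw [integral_eq_zero_of_ae h0]
    exact hε.le

end Mixing

/-! ### Bounded discrepancy of the rotation. -/

section Equidistribution

/-- The points of `[0, 1]` in the backward orbit of `0` under the rotation by `lam`. -/
def IsBreakpoint (lam a : ℝ) : Prop :=
  a ∈ Icc (0 : ℝ) 1 ∧ ∃ (d : ℤ) (j : ℕ), a = d - lam * j

/-- After cancellation only `j` differences between the two ends remain. -/
lemma abs_sum_sub_shift_le {v : ℕ → ℝ} (hv : ∀ i, v i ∈ Icc (0 : ℝ) 1) (j n : ℕ) :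
    |∑ i ∈ Finset.range n, (v i - v (i + j))| ≤ j := by
  have hsum : ∑ i ∈ Finset.range n, (v i - v (i + j)) =
      ∑ i ∈ Finset.range j, (v i - v (n + i)) := by
    have h1 := Finset.sum_range_add v n j
    have h2 := Finset.sum_range_add v j n
    rw [add_comm j n] at h2
    simp only [Finset.sum_sub_distrib, add_comm _ j]
    linarith
  rw [hsum]
  refine (Finset.abs_sum_le_sum_abs _ _).trans ?_
  refine (Finset.sum_le_card_nsmul _ _ 1 fun i _ => ?_).trans (by simp)
  rw [abs_le]
  constructor <;> linarith [(hv i).1, (hv i).2, (hv (n + i)).1, (hv (n + i)).2]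

/-- The centred indicator is a coboundary: for `x ∈ [0, 1)`, it equals `x - Int.fract (x - a)`, and
`x - a` agrees with `x + lam * j` modulo `1`. The sum telescopes, with `C = j` for all `t` and `n`.
-/
lemma IsBreakpoint.exists_discrepancy_le {lam a : ℝ} (ha : IsBreakpoint lam a) :
    ∃ C : ℝ, ∀ (t : ℝ) (n : ℕ), |∑ i ∈ Finset.range n,
      (Ici a).indicator (1 : ℝ → ℝ) (Int.fract (t + lam * i)) - n * (1 - a)| ≤ C := by
  obtain ⟨⟨ha0, ha1⟩, d, j, hdj⟩ := ha
  refine ⟨j, fun t n => ?_⟩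
  have hpt : ∀ i : ℕ, (Ici a).indicator (1 : ℝ → ℝ) (Int.fract (t + lam * i)) - (1 - a) =
      Int.fract (t + lam * i) - Int.fract (t + lam * (i + j : ℕ)) := by
    intro i
    have h0 := Int.fract_nonneg (t + lam * i)
    have h1 := Int.fract_lt_one (t + lam * i)
    have hfl := Int.floor_add_fract (t + lam * i)
    by_cases hai : a ≤ Int.fract (t + lam * i)
    · have : Int.fract (t + lam * (i + j : ℕ)) = Int.fract (t + lam * i) - a := by
        rw [Int.fract_eq_iff]
        refine ⟨by linarith, by linarith, ⌊t + lam * i⌋ + d, ?_⟩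
        push_cast
        linarith
      rw [indicator_of_mem (mem_Ici.2 hai), this, Pi.one_apply]
      ring
    · have : Int.fract (t + lam * (i + j : ℕ)) = Int.fract (t + lam * i) - a + 1 := by
        rw [Int.fract_eq_iff]
        refine ⟨by linarith, by linarith, ⌊t + lam * i⌋ + d - 1, ?_⟩
        push_cast
        linarith
      rw [indicator_of_notMem (by simpa using hai), this]
      ring
  have hsum := abs_sum_sub_shift_le (v := fun i : ℕ => Int.fract (t + lam * i))
    (fun i => ⟨Int.fract_nonneg _, (Int.fract_lt_one _).le⟩) j n
  have hc : (n : ℝ) * (1 - a) = ∑ _i ∈ Finset.range n, (1 - a) := by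
    rw [Finset.sum_const, Finset.card_range, nsmul_eq_mul]
  rw [hc, ← Finset.sum_sub_distrib, Finset.sum_congr rfl fun i _ => hpt i]
  exact hsum

/-- Orbits of the rotation visit an interval between breakpoints with bounded discrepancy. -/
lemma exists_card_discrepancy_le {lam a b : ℝ} (ha : IsBreakpoint lam a) (hb : IsBreakpoint lam b)
    (hab : a ≤ b) : ∃ C : ℝ, ∀ (t : ℝ) (n : ℕ),
      |(((Finset.range n).filter fun i : ℕ => Int.fract (t + lam * i) ∈ Ico a b).card : ℝ) -
        n * (b - a)| ≤ C := by
  obtain ⟨C, hC⟩ := ha.exists_discrepancy_le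
  obtain ⟨C', hC'⟩ := hb.exists_discrepancy_le
  refine ⟨C + C', fun t n => ?_⟩
  have hpt : ∀ x : ℝ, (Ico a b).indicator (1 : ℝ → ℝ) x =
      (Ici a).indicator (1 : ℝ → ℝ) x - (Ici b).indicator (1 : ℝ → ℝ) x := by
    intro x
    by_cases hax : a ≤ x <;> by_cases hbx : b ≤ x
    · simp [indicator, hax, hbx]
    · simp [indicator, hax, hbx]
    · exact absurd (hab.trans hbx) hax
    · simp [indicator, hax, hbx]
  have hcard : (((Finset.range n).filter fun i : ℕ => Int.fract (t + lam * i) ∈ Ico a b).card : ℝ) =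
      ∑ i ∈ Finset.range n, (Ico a b).indicator (1 : ℝ → ℝ) (Int.fract (t + lam * i)) := by
    rw [Finset.card_filter, Nat.cast_sum]
    refine Finset.sum_congr rfl fun i _ => ?_
    by_cases hi : Int.fract (t + lam * i) ∈ Ico a b
    · rw [if_pos hi, indicator_of_mem hi, Nat.cast_one, Pi.one_apply]
    · rw [if_neg hi, indicator_of_notMem hi, Nat.cast_zero]
  rw [hcard, Finset.sum_congr rfl fun i _ => hpt _, Finset.sum_sub_distrib]
  refine le_trans (le_of_eq ?_) ((abs_sub _ _).trans (add_le_add (hC t n) (hC' t n)))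
  congr 1
  ring

end Equidistribution

/-! ### The finitely many shapes of an initial window. -/

section Shapes

/-- The heights of the first `m` steps of the staircase with intercept `s`. -/
def shape (lam : ℝ) (m : ℕ) (s : ℝ) : Fin m → ℤ := fun j => ⌊lam * (j : ℕ) + s⌋

lemma shape_mem_piFinset {lam : ℝ} (hlam : lam ∈ Icc (0 : ℝ) 1) (m : ℕ) {s : ℝ}
    (hs : s ∈ Ico (0 : ℝ) 1) :
    shape lam m s ∈ Fintype.piFinset fun _ : Fin m => Finset.Icc (0 : ℤ) m := by
  rw [Fintype.mem_piFinset]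
  intro j
  have hj0 : (0 : ℝ) ≤ (j : ℕ) := Nat.cast_nonneg _
  have hj1 : (((j : ℕ) : ℝ)) + 1 ≤ m := by exact_mod_cast j.2
  rw [Finset.mem_Icc]
  constructor
  · exact Int.floor_nonneg.2 (add_nonneg (mul_nonneg hlam.1 hj0) hs.1)
  · have h : lam * (j : ℕ) + s ≤ m := by nlinarith [hlam.2, hs.2]
    exact_mod_cast (Int.floor_le (lam * (j : ℕ) + s)).trans h

/-- The intercepts with a given shape form an interval between breakpoints. -/
lemma exists_cell_eq_Ico (lam : ℝ) (m : ℕ) {s₀ : ℝ} (hs₀ : s₀ ∈ Ico (0 : ℝ) 1) :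
    ∃ a b, IsBreakpoint lam a ∧ IsBreakpoint lam b ∧ a ≤ b ∧
      ∀ s ∈ Ico (0 : ℝ) 1, shape lam m s = shape lam m s₀ ↔ s ∈ Ico a b := by
  set d := shape lam m s₀ with hd
  have hshape : ∀ s, shape lam m s = d ↔ ∀ j : Fin m,
      (d j : ℝ) - lam * (j : ℕ) ≤ s ∧ s < (d j : ℝ) + 1 - lam * (j : ℕ) := by
    intro s
    rw [funext_iff]
    refine forall_congr' fun j => ?_
    rw [shape, Int.floor_eq_iff]
    constructor <;> rintro ⟨h1, h2⟩ <;> constructor <;> linarith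
  -- The cell runs from the largest lower bound to the smallest upper bound; inserting `0` and `1`
  -- keeps it in `[0, 1]`, and both are breakpoints with `j = 0`.
  let A : Finset ℝ := insert 0 (Finset.univ.image fun j : Fin m => (d j : ℝ) - lam * (j : ℕ))
  let B : Finset ℝ := insert 1 (Finset.univ.image fun j : Fin m => (d j : ℝ) + 1 - lam * (j : ℕ))
  have hA : A.Nonempty := ⟨0, Finset.mem_insert_self _ _⟩
  have hB : B.Nonempty := ⟨1, Finset.mem_insert_self _ _⟩
  have hiff : ∀ s ∈ Ico (0 : ℝ) 1, shape lam m s = d ↔ s ∈ Ico (A.max' hA) (B.min' hB) := by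
    intro s hs
    rw [hshape, mem_Ico, Finset.max'_le_iff, Finset.lt_min'_iff]
    simp only [A, B, Finset.forall_mem_insert, Finset.forall_mem_image, Finset.mem_univ,
      true_implies, hs.1, hs.2, true_and, forall_and]
  have h₀ := (hiff s₀ hs₀).1 rfl
  refine ⟨A.max' hA, B.min' hB, ⟨⟨A.le_max' _ (Finset.mem_insert_self _ _),
    h₀.1.trans hs₀.2.le⟩, ?_⟩, ⟨⟨hs₀.1.trans h₀.2.le, B.min'_le _ (Finset.mem_insert_self _ _)⟩,
    ?_⟩, h₀.1.trans h₀.2.le, hiff⟩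
  · rcases Finset.mem_insert.1 (A.max'_mem hA) with h | h
    · exact ⟨0, 0, by rw [h]; simp⟩
    · obtain ⟨j, -, hj⟩ := Finset.mem_image.1 h
      exact ⟨d j, j, hj.symm⟩
  · rcases Finset.mem_insert.1 (B.min'_mem hB) with h | h
    · exact ⟨1, 0, by rw [h]; simp⟩
    · obtain ⟨j, -, hj⟩ := Finset.mem_image.1 h
      exact ⟨d j + 1, j, by rw [← hj]; push_cast; ring⟩

end Shapes

/-! ### Convergence of the averages under strong mixing. -/

section StronglyMixing

variable {Υ : Type*} {m : ℕ}

/-- The values of `f` on the window with heights `d`. -/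
def shapeValue (f : (Fin m → Υ) → ℝ) (d : Fin m → ℤ) (ω : Config Υ) : ℝ :=
  f fun j => ω (((j : ℕ) : ℤ), d j)

lemma apply_window_zero (f : (Fin m → Υ) → ℝ) (lam s : ℝ) (ω : Config Υ) :
    f (window lam s m 0 ω) = shapeValue f (shape lam m s) ω := by
  refine congrArg f (funext fun j => congrArg ω (Prod.ext (by simp [stair]) ?_))
  simp [stair, shape]

variable [MeasurableSpace Υ] {P : Measure (Config Υ)} {lam : ℝ}
  {f : (Fin m → Υ) → ℝ}

lemma integral_windowLaw_eq (hP : IsStationary P)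
    (hf : ∀ t ∈ Icc (0 : ℝ) 1, Integrable f (windowLaw P lam t m)) (s : ℝ) :
    ∫ y, f y ∂(windowLaw P lam s m) = ∫ ω, shapeValue f (shape lam m s) ω ∂P := by
  have h := integral_windowLaw_rotation_iterate hP hf s 0
  simpa only [Function.iterate_zero, id_eq, apply_window_zero] using h

variable [IsProbabilityMeasure P]

lemma tendsto_stairAverage_of_isStronglyMixing (hP : IsStationary P)
    (hlam : lam ∈ Icc (0 : ℝ) 1)
    (hf : ∀ t ∈ Icc (0 : ℝ) 1, Integrable f (windowLaw P lam t m)) (hmix : IsStronglyMixing P) :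
    IntervalIntegrable (fun t => ∫ y, f y ∂(windowLaw P lam t m)) volume 0 1 ∧
      Tendsto (fun n : ℕ => ⨆ t ∈ Icc (0 : ℝ) 1, eLpNorm (fun ω => stairAverage f lam t n ω -
        ∫ s in (0 : ℝ)..1, ∫ y, f y ∂(windowLaw P lam s m)) 1 P) atTop (𝓝 0) := by
  classical
  simp_rw [integral_windowLaw_eq hP hf]
  -- Only shapes that are attained are kept, since `hf` gives integrability of `shapeValue f d` for
  -- these alone.
  let D : Finset (Fin m → ℤ) := (Fintype.piFinset fun _ : Fin m => Finset.Icc (0 : ℤ) m).filter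
    fun d => ∃ s ∈ Ico (0 : ℝ) 1, shape lam m s = d
  have hD : ∀ s ∈ Ico (0 : ℝ) 1, shape lam m s ∈ D := fun s hs =>
    Finset.mem_filter.2 ⟨shape_mem_piFinset hlam m hs, s, hs, rfl⟩
  have hcell : ∀ d ∈ D, ∃ a b, IsBreakpoint lam a ∧ IsBreakpoint lam b ∧ a ≤ b ∧
      ∀ s ∈ Ico (0 : ℝ) 1, shape lam m s = d ↔ s ∈ Ico a b := by
    intro d hd
    obtain ⟨s, hs, rfl⟩ := (Finset.mem_filter.1 hd).2
    exact exists_cell_eq_Ico lam m hs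
  choose! a b ha hb hab hiff using hcell
  have hGi : ∀ d ∈ D, Integrable (shapeValue f d) P := by
    intro d hd
    obtain ⟨s, hs, rfl⟩ := (Finset.mem_filter.1 hd).2
    simpa only [apply_window_zero] using integrable_window hP hf s 0
  let G : (Fin m → ℤ) → ℝ := fun d => ∫ ω, shapeValue f d ω ∂P
  -- As a function of the intercept the expectation is a finite step function; this gives both its
  -- integrability and its integral.
  have hstep : ∀ s ∈ Ico (0 : ℝ) 1,
      G (shape lam m s) = ∑ d ∈ D, (Ico (a d) (b d)).indicator (fun _ => G d) s := by
    intro s hs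
    rw [Finset.sum_eq_single_of_mem _ (hD s hs), indicator_of_mem ((hiff _ (hD s hs) s hs).1 rfl)]
    intro d hd hne
    exact indicator_of_notMem (fun h => hne ((hiff d hd s hs).2 h).symm) _
  have hind : ∀ d ∈ D, IntegrableOn ((Ico (a d) (b d)).indicator fun _ => G d)
      (Ico (0 : ℝ) 1) volume := fun d _ =>
    (integrableOn_const (by simp)).indicator measurableSet_Ico
  have hint : IntegrableOn (fun s => G (shape lam m s)) (Ico (0 : ℝ) 1) volume :=
    IntegrableOn.congr_fun (integrable_finsetSum _ hind) (fun s hs => (hstep s hs).symm)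
      measurableSet_Ico
  have hI : ∫ s in (0 : ℝ)..1, G (shape lam m s) = ∑ d ∈ D, (b d - a d) * G d := by
    rw [intervalIntegral.integral_of_le zero_le_one, ← integral_Icc_eq_integral_Ioc,
      integral_Icc_eq_integral_Ico, setIntegral_congr_fun measurableSet_Ico hstep,
      integral_finsetSum _ hind]
    refine Finset.sum_congr rfl fun d hd => ?_
    rw [setIntegral_indicator measurableSet_Ico, inter_eq_right.2
      (Ico_subset_Ico (ha d hd).1.1 (hb d hd).1.2), setIntegral_const,
      Real.volume_real_Ico_of_le (hab d hd), smul_eq_mul]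
  refine ⟨(intervalIntegrable_iff_integrableOn_Ico_of_le zero_le_one).2 hint, ?_⟩
  change Tendsto (fun n : ℕ => ⨆ t ∈ Icc (0 : ℝ) 1, eLpNorm (fun ω => stairAverage f lam t n ω -
    ∫ s in (0 : ℝ)..1, G (shape lam m s)) 1 P) atTop (𝓝 0)
  rw [hI]
  have hdisc : ∀ d ∈ D, ∃ C : ℝ, ∀ (t : ℝ) (n : ℕ),
      |(((Finset.range n).filter fun i : ℕ => shape lam m (Int.fract (t + lam * i)) = d).card : ℝ) -
        n * (b d - a d)| ≤ C := by
    intro d hd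
    obtain ⟨C, hC⟩ := exists_card_discrepancy_le (ha d hd) (hb d hd) (hab d hd)
    refine ⟨C, fun t n => ?_⟩
    have := hC t n
    rwa [Finset.filter_congr fun i _ => (hiff d hd (Int.fract (t + lam * (i : ℕ)))
      ⟨Int.fract_nonneg _, Int.fract_lt_one _⟩).symm] at this
  choose! C hC using hdisc
  let S : ℝ → ℕ → (Fin m → ℤ) → Finset ℕ := fun t n d =>
    (Finset.range n).filter fun i : ℕ => shape lam m (Int.fract (t + lam * i)) = d
  -- For each shape: the fluctuation over its visit times, plus the deviation of its visit frequency
  -- from the cell length.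
  have hdecomp : ∀ (t : ℝ) (n : ℕ) (ω : Config Υ),
      stairAverage f lam t n ω - ∑ d ∈ D, (b d - a d) * G d =
        ∑ d ∈ D, (centredAverage P (shapeValue f d) n (fun i => stair lam t i) (S t n d) ω +
          ((n : ℝ)⁻¹ * (S t n d).card - (b d - a d)) * G d) := by
    intro t n ω
    have hsum : ∑ i ∈ Finset.range n, f (window lam t m i ω) =
        ∑ d ∈ D, ∑ i ∈ S t n d, shapeValue f d (shift (stair lam t i) ω) := by
      rw [← Finset.sum_fiberwise_of_maps_to (t := D)
        (g := fun i : ℕ => shape lam m (Int.fract (t + lam * i)))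
        fun i _ => hD _ ⟨Int.fract_nonneg _, Int.fract_lt_one _⟩]
      refine Finset.sum_congr rfl fun d _ => Finset.sum_congr rfl fun i hi => ?_
      rw [window_eq_window_shift, apply_window_zero f, (Finset.mem_filter.1 hi).2]
    rw [stairAverage, hsum, Finset.mul_sum, ← Finset.sum_sub_distrib]
    refine Finset.sum_congr rfl fun d _ => ?_
    rw [centredAverage, Finset.sum_sub_distrib, Finset.sum_const, nsmul_eq_mul]
    ring
  have hsmall : ∀ ε > 0, ∀ᶠ n : ℕ in atTop, ∀ t : ℝ,
      ∫ ω, |stairAverage f lam t n ω - ∑ d ∈ D, (b d - a d) * G d| ∂P ≤ ε := by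
    intro ε hε
    -- Each shape costs `η` twice, once per error; the `+ 1` keeps the denominator positive without
    -- discussing whether `D` is empty.
    set η := ε / (2 * (D.card + 1)) with hη
    have hηpos : 0 < η := by positivity
    have h1 : ∀ᶠ n : ℕ in atTop, ∀ d ∈ D, ∀ w : ℕ → ℤ × ℤ, (∀ i, (w i).1 = i) →
        ∀ S ⊆ Finset.range n, ∫ ω, |centredAverage P (shapeValue f d) n w S ω| ∂P ≤ η :=
      (Finset.eventually_all _).2 fun d hd =>
        uniformlyAveraging_of_isStronglyMixing hP hmix (hGi d hd) η hηpos
    have h2 : ∀ᶠ n : ℕ in atTop, ∀ d ∈ D, C d * |G d| / n < η :=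
      (Finset.eventually_all _).2 fun d _ =>
        (tendsto_const_nhds.div_atTop tendsto_natCast_atTop_atTop).eventually_lt_const hηpos
    filter_upwards [h1, h2, eventually_gt_atTop 0] with n hn1 hn2 hn0 t
    have hn' : (0 : ℝ) < n := by exact_mod_cast hn0
    have hci : ∀ d ∈ D, Integrable (centredAverage P (shapeValue f d) n
        (fun i => stair lam t i) (S t n d)) P := fun d hd =>
      integrable_centredAverage hP (hGi d hd) _ _ _
    have hterm : ∀ d ∈ D, |((n : ℝ)⁻¹ * (S t n d).card - (b d - a d)) * G d| ≤ η := by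
      intro d hd
      have heq : (n : ℝ)⁻¹ * (S t n d).card - (b d - a d) =
          (((S t n d).card : ℝ) - n * (b d - a d)) / n := by field_simp
      refine le_trans ?_ (hn2 d hd).le
      rw [heq, abs_mul, abs_div, abs_of_pos hn', div_mul_eq_mul_div]
      gcongr
      exact hC d hd t n
    calc ∫ ω, |stairAverage f lam t n ω - ∑ d ∈ D, (b d - a d) * G d| ∂P
        ≤ ∫ ω, ∑ d ∈ D, (|centredAverage P (shapeValue f d) n (fun i => stair lam t i)
            (S t n d) ω| + η) ∂P := by
          refine integral_mono
            ((integrable_stairAverage hP hf t n).sub (integrable_const _)).abs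
            (integrable_finsetSum _ fun d hd => (hci d hd).abs.add (integrable_const _)) fun ω => ?_
          change |stairAverage f lam t n ω - _| ≤ _
          rw [hdecomp]
          exact (Finset.abs_sum_le_sum_abs _ _).trans (Finset.sum_le_sum fun d hd =>
            (abs_add_le _ _).trans (add_le_add le_rfl (hterm d hd)))
      _ = ∑ d ∈ D, (∫ ω, |centredAverage P (shapeValue f d) n (fun i => stair lam t i)
            (S t n d) ω| ∂P + η) := by
          have hci' : ∀ d ∈ D, Integrable (fun ω => |centredAverage P (shapeValue f d) n
              (fun i => stair lam t i) (S t n d) ω| + η) P := fun d hd =>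
            (hci d hd).abs.add (integrable_const _)
          rw [integral_finsetSum _ hci']
          refine Finset.sum_congr rfl fun d hd => ?_
          rw [integral_add (hci d hd).abs (integrable_const _)]
          simp
      _ ≤ ∑ d ∈ D, (η + η) := Finset.sum_le_sum fun d hd => add_le_add
          (hn1 d hd _ (fun _ => rfl) _ (Finset.filter_subset _ _)) le_rfl
      _ = D.card * (2 * η) := by rw [Finset.sum_const, nsmul_eq_mul, two_mul]
      _ ≤ (D.card + 1) * (2 * η) := by gcongr; linarith
      _ = ε := by rw [hη]; field_simp
  rw [ENNReal.tendsto_nhds_zero]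
  intro ε hε
  obtain ⟨δ, hδ0, hδ⟩ := ENNReal.lt_iff_exists_real_btwn.1 hε |>.imp fun δ h =>
    (⟨ENNReal.ofReal_pos.1 h.2.1, h.2.2.le⟩ : 0 < δ ∧ ENNReal.ofReal δ ≤ ε)
  filter_upwards [hsmall δ hδ0] with n hn
  refine iSup₂_le fun t _ => le_trans ?_ hδ
  have hi : Integrable (fun ω => stairAverage f lam t n ω - ∑ d ∈ D, (b d - a d) * G d) P :=
    (integrable_stairAverage hP hf t n).sub (integrable_const _)
  rw [eLpNorm_one_eq_lintegral_enorm, ← ofReal_integral_norm_eq_lintegral_enorm hi]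
  exact ENNReal.ofReal_le_ofReal (hn t)

end StronglyMixing

end Staircase

end

theorem corollary4p9 {Υ : Type*} [MeasurableSpace Υ]
    (P : Measure (Staircase.Config Υ)) [IsProbabilityMeasure P]
    (hP : Staircase.IsStationary P)
    (m : ℕ) (lam : ℝ) (hlam : lam ∈ Icc (0 : ℝ) 1)
    (f : (Fin m → Υ) → ℝ)
    (hf : ∀ t ∈ Icc (0 : ℝ) 1, Integrable f (Staircase.windowLaw P lam t m)) :
    -- the averages belong to `L¹(P)`
    (∀ t ∈ Icc (0 : ℝ) 1, ∀ n : ℕ, Integrable (Staircase.stairAverage f lam t n) P) ∧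
    -- rational slope
    (∀ (p : ℤ) (q : ℕ), 0 < q → IsCoprime p (q : ℤ) → lam = (p : ℝ) / (q : ℝ) →
      Ergodic (Staircase.shift ((q : ℤ), p)) P →
        Tendsto (fun n : ℕ => ⨆ t ∈ Icc (0 : ℝ) 1,
          eLpNorm (fun ω => Staircase.stairAverage f lam t n ω -
            (1 / (q : ℝ)) * ∑ ν ∈ Finset.range q,
              ∫ y, f y ∂(Staircase.windowLaw P lam ((Staircase.rotation lam)^[ν] t) m)) 1 P)
          atTop (𝓝 0) ∧
        ∀ᵐ ω ∂P, TendstoUniformlyOn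
          (fun (n : ℕ) (t : ℝ) => Staircase.stairAverage f lam t n ω)
          (fun t : ℝ => (1 / (q : ℝ)) * ∑ ν ∈ Finset.range q,
            ∫ y, f y ∂(Staircase.windowLaw P lam ((Staircase.rotation lam)^[ν] t) m))
          atTop (Icc (0 : ℝ) 1)) ∧
    -- irrational slope
    (Irrational lam →
      (∀ᵐ ω ∂P, Staircase.RiemannIntegrableUnit
        (fun t => f (Staircase.window lam t m 0 ω))) →
      Staircase.IsStronglyMixing P →
        IntervalIntegrable (fun t => ∫ y, f y ∂(Staircase.windowLaw P lam t m)) volume 0 1 ∧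
        Tendsto (fun n : ℕ => ⨆ t ∈ Icc (0 : ℝ) 1,
          eLpNorm (fun ω => Staircase.stairAverage f lam t n ω -
            ∫ s in (0 : ℝ)..1, ∫ y, f y ∂(Staircase.windowLaw P lam s m)) 1 P)
          atTop (𝓝 0)) := by
  refine ⟨fun t _ n => Staircase.integrable_stairAverage hP hf t n, fun p q hq _ hpq herg => ?_,
    fun _ _ hmix => Staircase.tendsto_stairAverage_of_isStronglyMixing hP hlam hf hmix⟩
  exact Staircase.tendsto_stairAverage_rational hP hf p hq hpq herg
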